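/- Let $\tau=\frac{1+\sqrt5}{2}$. The geometric Fibonacci inflation rule $\varrho$ acts on tilings of $\mathbb{R}$ by intervals of type $a$ (length $\tau$) and type $b$ (length $1$): each interval is stretched by the factor $\tau$ and dissected into intervals of the original lengths according to $a\mapsto ab$, $b\mapsto a$. Let $\Lambda=\Lambda_a\,\dot\cup\,\Lambda_b$ be the set of left endpoints of the intervals, coloured by type, of the fixed point of $\varrho^2$ with seed $a|a$, where the marker $|$ is placed at $0$. For $\alpha,\beta\in\{a,b\}$ and $z\in\mathbb{R}$, let \[ \nu_{\alpha\beta}(z)=\lim_{R\to\infty} \frac{\operatorname{card}\{x\in\Lambda_\alpha\cap(-R,R) : x+z\in\Lambda_\beta\cap(-R,R)\}} {\operatorname{card}\bigl(\Lambda\cap(-R,R)\bigr)} \] be the relative frequency (per point of $\Lambda$) of pairs of points at signed distance $z$, with the first point of type $\alpha$ and the second of type $\beta$. Then all these limits exist. For every $z\in\mathbb{Z}[\tau]$, one has \[ \begin{aligned} \nu_{aa}(z)&=\tfrac1\tau\bigl(\nu_{aa}(\tfrac z\tau)+\nu_{ab}(\tfrac z\tau)+\nu_{ba}(\tfrac z\tau)+\nu_{bb}(\tfrac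 z\tau)\bigr),\\ \nu_{ab}(z)&=\tfrac1\tau\bigl(\nu_{aa}(\tfrac z\tau-1)+\nu_{ba}(\tfrac z\tau-1)\bigr),\\ \nu_{ba}(z)&=\tfrac1\tau\bigl(\nu_{aa}(\tfrac z\tau+1)+\nu_{ab}(\tfrac z\tau+1)\bigr),\\ \nu_{bb}(z)&=\tfrac1\tau\,\nu_{aa}(\tfrac z\tau). \end{aligned} \] Moreover, $\nu_{\alpha\beta}(z)=0$ for all $\alpha,\beta\in\{a,b\}$ and all real $z\notin\Lambda_\beta-\Lambda_\alpha=\{y-x : y\in\Lambda_\beta,\ x\in\Lambda_\alpha\}$. -/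

import Mathlib

open Filter Topology
open scoped Pointwise

noncomputable section

namespace FibonacciChain

/-- The two letters (tile types) of the Fibonacci chain. -/
inductive Letter : Type
  | a : Letter
  | b : Letter

/-- The substitution `a ↦ ab`, `b ↦ a`. -/
def subst : Letter → List Letter
  | .a => [.a, .b]
  | .b => [.a]

/-- Tile lengths: `τ` (the golden ratio) for `a`, and `1` for `b`. -/
def tileLength : Letter → ℝ
  | .a => Real.goldenRatio
  | .b => 1

/-- The length of the patch obtained by concatenating the tiles of a finite word. -/
def wordLength (w : List Letter) : ℝ := (w.map tileLength).sum

/-- A set of tiles, encoded as a coloured point set: `P α` is the set of left endpoints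
of the tiles of type `α`. -/
abbrev ColouredSet : Type := Letter → Set ℝ

/-- The geometric inflation rule: a tile of type `β` with left endpoint `x` is stretched by `τ`
and dissected into tiles of the original sizes, according to the word `subst β`. The letter of
`subst β` that is preceded by `pre` becomes a tile with left endpoint `τ x + wordLength pre`. -/
def inflate (P : ColouredSet) : ColouredSet := fun α =>
  {y | ∃ β : Letter, ∃ x ∈ P β, ∃ pre suf : List Letter,
    subst β = pre ++ α :: suf ∧ y = Real.goldenRatio * x + wordLength pre}

/-- The seed `a|a`, with the marker `|` at `0`: one tile of type `a` ending at `0`, and one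
starting at `0`. -/
def seed : ColouredSet
  | .a => {-tileLength .a, 0}
  | .b => ∅

/-- The coloured point set `Λ` of the Fibonacci chain: the fixed point of the square of the
inflation rule with seed `a|a`. The patches obtained from the seed by iterating the squared rule
are nested and exhaust the line, so that their limit is their union. `points α` is the set of
left endpoints of the tiles of type `α`. -/
def points : ColouredSet := fun α => ⋃ n : ℕ, (inflate^[2 * n] seed) α

/-- The set of all left endpoints, disregarding the tile type. -/
def allPoints : Set ℝ := points .a ∪ points .b

/-- The relative frequency, per point of `Λ`, of pairs consisting of a point `x` of type `α` and
a point `x + z` of type `β`, both taken from the window `(-R, R)`. -/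
def pairFrequency (α β : Letter) (z R : ℝ) : ℝ :=
  (Set.ncard {x : ℝ | x ∈ points α ∩ Set.Ioo (-R) R ∧ x + z ∈ points β ∩ Set.Ioo (-R) R} : ℝ) /
    (Set.ncard (allPoints ∩ Set.Ioo (-R) R) : ℝ)

/-- The pair correlation coefficient `ν_{αβ}(z)`: the limit of the relative frequencies of pairs
with a point of type `α` at `x` and a point of type `β` at `x + z`. -/
def pairCorrelation (α β : Letter) (z : ℝ) : ℝ :=
  limUnder atTop (pairFrequency α β z)

end FibonacciChain

end

open FibonacciChain

/-!
The proof identifies the Fibonacci chain with a cut-and-project set and reads off the pair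
correlations as lengths of overlaps of windows.

Every point of `Λ` lies in `ℤ[φ]`, and `m + n φ` belongs to `Λ_α` exactly if its algebraic conjugate
`m + n ψ` lies in the window `W_α`, where `W_a = (-1 - ψ, -ψ]` and `W_b = (-1, -1 - ψ]`
(`points_eq_modelIoc`). Under conjugation the inflation rule becomes `W_a = ψ (W_a ∪ W_b)` and
`W_b = ψ W_a + ψ` up to endpoints; since `ψ < 0`, it interchanges the windows above with the same
windows closed on the left and open on the right, which is why `Λ` is a fixed point of the square of
the rule only. Conversely, the parent of `m + n φ` in the other model set has `n`-coordinate `m`,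
which is smaller than `n` in absolute value when `|n| > 2`; so every point of a model set descends
from the seed (`model_le_points`).

Pairs at distance `z = k + l φ` correspond to points of `ℤ[φ]` with conjugate in
`W_α ∩ (W_β - (k + l ψ))`, an interval with endpoints in `ℤ[ψ]`. For such an interval `(p, q]` the
number of points `m + n φ` in the `n`-th row is `⌊q - n ψ⌋ - ⌊p - n ψ⌋`. As `p` and `q` are in `ℤ[ψ]`, the
fractional parts of `q - n ψ` and `p - n ψ` form shifts of one bounded sequence, so that their sums
cancel up to a bounded error (`abs_sum_fract_sub_le`). No equidistribution theorem is needed, and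
the frequency is the length of the overlap divided by the total window length `φ`
(`tendsto_pairFrequency`). For the remaining `z` there are no pairs at all.

The renormalisation relations are then the self-similarity of the windows: lengths of overlaps are
additive and are multiplied by `-ψ = 1 / φ` under the reflection-contraction `x ↦ ψ x`.
-/

namespace FibonacciChain

open scoped goldenRatio

/-! ### The ring `ℤ[φ]` and its conjugation -/

/-- The element `m + n φ` of `ℤ[φ]`, given by its coordinates. -/
noncomputable def emb (v : ℤ × ℤ) : ℝ := v.1 + v.2 * φ

/-- The algebraic conjugate `m + n ψ` of `m + n φ`, as a function of the coordinates. -/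
noncomputable def conj (v : ℤ × ℤ) : ℝ := v.1 + v.2 * ψ

lemma emb_add (v w : ℤ × ℤ) : emb (v + w) = emb v + emb w := by
  simp only [emb, Prod.fst_add, Prod.snd_add]; push_cast; ring

lemma conj_add (v w : ℤ × ℤ) : conj (v + w) = conj v + conj w := by
  simp only [conj, Prod.fst_add, Prod.snd_add]; push_cast; ring

lemma conj_sub (v w : ℤ × ℤ) : conj (v - w) = conj v - conj w := by
  simp only [conj, Prod.fst_sub, Prod.snd_sub]; push_cast; ring

lemma emb_injective : Function.Injective emb := by
  rintro ⟨m, n⟩ ⟨m', n'⟩ h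
  simp only [emb] at h
  have hn : n = n' := by
    by_contra hne
    have h0 : ((n - n' : ℤ) : ℝ) ≠ 0 := by exact_mod_cast sub_ne_zero.2 hne
    refine (Real.goldenRatio_irrational.ne_rat ((m' - m : ℤ) / (n - n' : ℤ))) ?_
    push_cast at h0 ⊢
    rw [eq_div_iff h0]
    linarith
  subst hn
  have : (m : ℝ) = m' := by linarith
  simpa using this

lemma emb_sub_conj (v : ℤ × ℤ) : emb v - conj v = v.2 * √5 := by
  simp only [emb, conj]
  rw [← Real.goldenRatio_sub_goldenConj]; ring

/-- The coordinates of `φ x` in terms of those of `x`. -/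
def mulPhi (v : ℤ × ℤ) : ℤ × ℤ := (v.2, v.1 + v.2)

/-- The coordinates of `x / φ` in terms of those of `x`. -/
def divPhi (v : ℤ × ℤ) : ℤ × ℤ := (v.2 - v.1, v.1)

lemma mulPhi_divPhi (v : ℤ × ℤ) : mulPhi (divPhi v) = v := by
  simp [mulPhi, divPhi]

lemma emb_mulPhi (v : ℤ × ℤ) : emb (mulPhi v) = φ * emb v := by
  simp only [emb, mulPhi]; push_cast
  linear_combination (-(v.2 : ℝ)) * Real.goldenRatio_sq

lemma conj_mulPhi (v : ℤ × ℤ) : conj (mulPhi v) = ψ * conj v := by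
  simp only [conj, mulPhi]; push_cast
  linear_combination (-(v.2 : ℝ)) * Real.goldenConj_sq

lemma emb_divPhi (v : ℤ × ℤ) : emb (divPhi v) = emb v / φ := by
  rw [eq_div_iff Real.goldenRatio_ne_zero, mul_comm, ← emb_mulPhi, mulPhi_divPhi]

lemma conj_eq_mul_conj_divPhi (v : ℤ × ℤ) : conj v = ψ * conj (divPhi v) := by
  rw [← conj_mulPhi, mulPhi_divPhi]

lemma exists_emb_of_mem_adjoin {z : ℝ} (hz : z ∈ Algebra.adjoin ℤ {φ}) : ∃ v, emb v = z := by
  induction hz using Algebra.adjoin_induction with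
  | mem x hx => exact ⟨(0, 1), by simp [emb, Set.mem_singleton_iff.1 hx]⟩
  | algebraMap r => exact ⟨(r, 0), by simp [emb]⟩
  | add x y _ _ hx hy =>
    obtain ⟨v, rfl⟩ := hx
    obtain ⟨w, rfl⟩ := hy
    exact ⟨v + w, emb_add v w⟩
  | mul x y _ _ hx hy =>
    obtain ⟨v, rfl⟩ := hx
    obtain ⟨w, rfl⟩ := hy
    refine ⟨(v.1 * w.1 + v.2 * w.2, v.1 * w.2 + v.2 * w.1 + v.2 * w.2), ?_⟩
    simp only [emb]; push_cast
    linear_combination (-(v.2 : ℝ) * w.2) * Real.goldenRatio_sq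

lemma goldenConj_bounds : -0.62 < ψ ∧ ψ < -0.61 := by
  have h := Real.goldenConj_sq
  have h0 := Real.goldenConj_neg
  constructor <;> nlinarith

/-! ### The Fibonacci chain as a cut-and-project set -/

/-- Left endpoint of the window of the points of type `α`. -/
noncomputable def winLeft : Letter → ℝ
  | .a => -1 - ψ
  | .b => -1

/-- Right endpoint of the window of the points of type `α`. -/
noncomputable def winRight : Letter → ℝ
  | .a => -ψ
  | .b => -1 - ψ

/-- The points of `ℤ[φ]` whose conjugate lies in the window of type `α`, where the window contains
its right endpoint but not its left one. -/
def modelIoc : ColouredSet := fun α => emb '' (conj ⁻¹' Set.Ioc (winLeft α) (winRight α))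

/-- The points of `ℤ[φ]` whose conjugate lies in the window of type `α`, where the window contains
its left endpoint but not its right one. -/
def modelIco : ColouredSet := fun α => emb '' (conj ⁻¹' Set.Ico (winLeft α) (winRight α))

lemma mem_inflate_a {P : ColouredSet} {y : ℝ} :
    y ∈ inflate P .a ↔ ∃ β, ∃ x ∈ P β, y = φ * x := by
  constructor
  · rintro ⟨β, x, hx, pre, suf, h, rfl⟩
    refine ⟨β, x, hx, ?_⟩
    cases β <;> rcases pre with _ | ⟨c, _ | ⟨d, pre⟩⟩ <;> simp_all [subst, wordLength]
  · rintro ⟨β, x, hx, rfl⟩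
    cases β
    · exact ⟨.a, x, hx, [], [.b], rfl, by simp [wordLength]⟩
    · exact ⟨.b, x, hx, [], [], rfl, by simp [wordLength]⟩

lemma mem_inflate_b {P : ColouredSet} {y : ℝ} :
    y ∈ inflate P .b ↔ ∃ x ∈ P .a, y = φ * x + φ := by
  constructor
  · rintro ⟨β, x, hx, pre, suf, h, rfl⟩
    cases β <;> rcases pre with _ | ⟨c, _ | ⟨d, pre⟩⟩ <;>
      simp_all [subst, wordLength]
    obtain rfl := h.1
    exact ⟨x, hx, by simp [tileLength]⟩
  · rintro ⟨x, hx, rfl⟩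
    exact ⟨.a, x, hx, [.a], [], rfl, by simp [wordLength, tileLength]⟩

lemma inflate_mono {P Q : ColouredSet} (h : P ≤ Q) : inflate P ≤ inflate Q := by
  rintro α y ⟨β, x, hx, hy⟩
  exact ⟨β, x, h β hx, hy⟩

lemma inflate_modelIco_le : inflate modelIco ≤ modelIoc := by
  have hψ := goldenConj_bounds
  have hsq := Real.goldenConj_sq
  rintro (_ | _) y hy
  · obtain ⟨β, x, ⟨v, hv, rfl⟩, rfl⟩ := mem_inflate_a.1 hy
    refine ⟨mulPhi v, ?_, emb_mulPhi v⟩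
    have h1 : -1 ≤ conj v ∧ conj v < -ψ := by
      cases β <;> simp only [winLeft, winRight, Set.mem_preimage, Set.mem_Ico] at hv <;>
        constructor <;> linarith
    simp only [winLeft, winRight, Set.mem_preimage, Set.mem_Ioc, conj_mulPhi]
    constructor <;> nlinarith
  · obtain ⟨x, ⟨v, hv, rfl⟩, rfl⟩ := mem_inflate_b.1 hy
    refine ⟨mulPhi v + (0, 1), ?_, by rw [emb_add, emb_mulPhi]; simp [emb]⟩
    simp only [winLeft, winRight, Set.mem_preimage, Set.mem_Ico] at hv
    simp only [winLeft, winRight, Set.mem_preimage, Set.mem_Ioc, conj_add, conj_mulPhi,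
      show conj (0, 1) = ψ by simp [conj]]
    constructor <;> nlinarith

lemma inflate_modelIoc_le : inflate modelIoc ≤ modelIco := by
  have hψ := goldenConj_bounds
  have hsq := Real.goldenConj_sq
  rintro (_ | _) y hy
  · obtain ⟨β, x, ⟨v, hv, rfl⟩, rfl⟩ := mem_inflate_a.1 hy
    refine ⟨mulPhi v, ?_, emb_mulPhi v⟩
    have h1 : -1 < conj v ∧ conj v ≤ -ψ := by
      cases β <;> simp only [winLeft, winRight, Set.mem_preimage, Set.mem_Ioc] at hv <;>
        constructor <;> linarith
    simp only [winLeft, winRight, Set.mem_preimage, Set.mem_Ico, conj_mulPhi]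
    constructor <;> nlinarith
  · obtain ⟨x, ⟨v, hv, rfl⟩, rfl⟩ := mem_inflate_b.1 hy
    refine ⟨mulPhi v + (0, 1), ?_, by rw [emb_add, emb_mulPhi]; simp [emb]⟩
    simp only [winLeft, winRight, Set.mem_preimage, Set.mem_Ioc] at hv
    simp only [winLeft, winRight, Set.mem_preimage, Set.mem_Ico, conj_add, conj_mulPhi,
      show conj (0, 1) = ψ by simp [conj]]
    constructor <;> nlinarith

lemma seed_le_modelIoc : seed ≤ modelIoc := by
  have hψ := goldenConj_bounds
  rintro (_ | _) y hy
  · rcases hy with rfl | hy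
    · exact ⟨(0, -1), by
        simp only [winLeft, winRight, Set.mem_preimage, Set.mem_Ioc, conj]; push_cast
        constructor <;> linarith, by simp [emb, tileLength]⟩
    · rw [Set.mem_singleton_iff.1 hy]
      exact ⟨(0, 0), by
        simp only [winLeft, winRight, Set.mem_preimage, Set.mem_Ioc, conj]; push_cast
        constructor <;> linarith, by simp [emb]⟩
  · exact hy.elim

lemma points_le_modelIoc : points ≤ modelIoc := by
  have key : ∀ n : ℕ, inflate^[2 * n] seed ≤ modelIoc := by
    intro n
    induction n with
    | zero => exact seed_le_modelIoc
    | succ n ih =>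
      rw [show 2 * (n + 1) = 2 * n + 1 + 1 by ring, Function.iterate_succ_apply',
        Function.iterate_succ_apply']
      exact (inflate_mono ((inflate_mono ih).trans inflate_modelIoc_le)).trans
        inflate_modelIco_le
  intro α x hx
  obtain ⟨n, hn⟩ := Set.mem_iUnion.1 hx
  exact key n α hn

lemma inflate_inflate_points_le : inflate (inflate points) ≤ points := by
  rintro α y ⟨β, x, ⟨γ, w, hw, hx⟩, hy⟩
  obtain ⟨n, hn⟩ := Set.mem_iUnion.1 hw
  refine Set.mem_iUnion.2 ⟨n + 1, ?_⟩
  rw [show 2 * (n + 1) = 2 * n + 1 + 1 by ring, Function.iterate_succ_apply',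
    Function.iterate_succ_apply']
  exact ⟨β, x, ⟨γ, w, hn, hx⟩, hy⟩

lemma seed_le_points : seed ≤ points := fun _ _ hx => Set.mem_iUnion.2 ⟨0, hx⟩

lemma emb_mem_inflate_a {P : ColouredSet} {β : Letter} {v : ℤ × ℤ} (h : emb (divPhi v) ∈ P β) :
    emb v ∈ inflate P .a :=
  mem_inflate_a.2 ⟨β, _, h, by rw [← emb_mulPhi, mulPhi_divPhi]⟩

lemma emb_mem_inflate_b {P : ColouredSet} {v : ℤ × ℤ} (h : emb (divPhi v - (1, 0)) ∈ P .a) :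
    emb v ∈ inflate P .b := by
  refine mem_inflate_b.2 ⟨_, h, ?_⟩
  have h1 : emb (divPhi v - (1, 0)) = emb (divPhi v) - 1 := by
    rw [eq_sub_iff_add_eq, show (1 : ℝ) = emb (1, 0) by simp [emb], ← emb_add, sub_add_cancel]
  rw [h1, emb_divPhi]
  field_simp [Real.goldenRatio_ne_zero]
  ring

/-- A point of the model set with half-open windows `(·, ·]` lies in the inflation of any set
that contains its parent in the model set with windows `[·, ·)`. -/
lemma mem_inflate_of_conj_mem_Ioc {P : ColouredSet} {α : Letter} {v : ℤ × ℤ}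
    (hv : conj v ∈ Set.Ioc (winLeft α) (winRight α))
    (hP : ∀ β w, w.2 = v.1 → conj w ∈ Set.Ico (winLeft β) (winRight β) → emb w ∈ P β) :
    emb v ∈ inflate P α := by
  have hψ := goldenConj_bounds
  have hsq := Real.goldenConj_sq
  rw [conj_eq_mul_conj_divPhi] at hv
  rcases α with _ | _ <;> simp only [winLeft, winRight, Set.mem_Ioc] at hv
  · have h1 : -1 ≤ conj (divPhi v) := by nlinarith
    have h2 : conj (divPhi v) < -ψ := by nlinarith
    by_cases h : conj (divPhi v) < -1 - ψ
    · exact emb_mem_inflate_a (hP .b _ rfl ⟨h1, h⟩)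
    · exact emb_mem_inflate_a (hP .a _ rfl ⟨not_lt.1 h, h2⟩)
  · refine emb_mem_inflate_b (hP .a _ (by simp [divPhi]) ?_)
    have h1 : conj (divPhi v - (1, 0)) = conj (divPhi v) - 1 := by rw [conj_sub]; simp [conj]
    simp only [h1, winLeft, winRight, Set.mem_Ico]
    constructor <;> nlinarith

/-- A point of the model set with half-open windows `[·, ·)` lies in the inflation of any set
that contains its parent in the model set with windows `(·, ·]`. -/
lemma mem_inflate_of_conj_mem_Ico {P : ColouredSet} {α : Letter} {v : ℤ × ℤ}
    (hv : conj v ∈ Set.Ico (winLeft α) (winRight α))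
    (hP : ∀ β w, w.2 = v.1 → conj w ∈ Set.Ioc (winLeft β) (winRight β) → emb w ∈ P β) :
    emb v ∈ inflate P α := by
  have hψ := goldenConj_bounds
  have hsq := Real.goldenConj_sq
  rw [conj_eq_mul_conj_divPhi] at hv
  rcases α with _ | _ <;> simp only [winLeft, winRight, Set.mem_Ico] at hv
  · have h1 : -1 < conj (divPhi v) := by nlinarith
    have h2 : conj (divPhi v) ≤ -ψ := by nlinarith
    by_cases h : conj (divPhi v) ≤ -1 - ψ
    · exact emb_mem_inflate_a (hP .b _ rfl ⟨h1, h⟩)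
    · exact emb_mem_inflate_a (hP .a _ rfl ⟨not_le.1 h, h2⟩)
  · refine emb_mem_inflate_b (hP .a _ (by simp [divPhi]) ?_)
    have h1 : conj (divPhi v - (1, 0)) = conj (divPhi v) - 1 := by rw [conj_sub]; simp [conj]
    simp only [h1, winLeft, winRight, Set.mem_Ioc]
    constructor <;> nlinarith

/-- The points `m + n φ` of the two model sets with `|n| ≤ 2`: the finitely many points where the
descent along parents need not decrease `|n|`. -/
lemma model_base {α : Letter} {m n : ℤ} (hn : |n| ≤ 2) :
    (conj (m, n) ∈ Set.Ioc (winLeft α) (winRight α) → emb (m, n) ∈ points α) ∧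
    (conj (m, n) ∈ Set.Ico (winLeft α) (winRight α) → emb (m, n) ∈ inflate points α) := by
  have hψ := goldenConj_bounds
  have toP : ∀ {α x}, x ∈ inflate (inflate points) α → x ∈ points α :=
    fun {α x} h => inflate_inflate_points_le α h
  -- a point `v` of type `a` descends from `divPhi v`, and one of type `b` from `divPhi v - (1, 0)`
  have pa0 : emb (0, 0) ∈ points .a := seed_le_points .a (by simp [seed, emb])
  have pa1 : emb (0, -1) ∈ points .a := seed_le_points .a (by simp [seed, emb, tileLength])
  have qa0 : emb (0, 0) ∈ inflate points .a := emb_mem_inflate_a pa0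
  have qb0 : emb (0, 1) ∈ inflate points .b := emb_mem_inflate_b pa0
  have qa1 : emb (-1, -1) ∈ inflate points .a := emb_mem_inflate_a pa1
  have qb1 : emb (-1, 0) ∈ inflate points .b := emb_mem_inflate_b pa1
  have pb0 : emb (0, 1) ∈ points .b := toP (emb_mem_inflate_b qa0)
  have pb1 : emb (-1, -1) ∈ points .b := toP (emb_mem_inflate_b qa1)
  have pa2 : emb (1, 1) ∈ points .a := toP (emb_mem_inflate_a qb0)
  have qa2 : emb (1, 1) ∈ inflate points .a := emb_mem_inflate_a pb0
  have qa3 : emb (1, 2) ∈ inflate points .a := emb_mem_inflate_a pa2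
  have pa3 : emb (1, 2) ∈ points .a := toP (emb_mem_inflate_a qa2)
  have pa4 : emb (-1, -2) ∈ points .a := toP (emb_mem_inflate_a qa1)
  have qa4 : emb (-1, -2) ∈ inflate points .a := emb_mem_inflate_a pb1
  have pb2 : emb (-2, -2) ∈ points .b := toP (emb_mem_inflate_b qa4)
  have qb2 : emb (-2, -2) ∈ inflate points .b := emb_mem_inflate_b pa4
  have aux : ∀ {k : ℤ}, (k : ℝ) < 3 → -3 < (k : ℝ) → k ≤ 2 ∧ -2 ≤ k := by
    intro k h1 h2
    have h1' : k < 3 := by exact_mod_cast h1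
    have h2' : -3 < k := by exact_mod_cast h2
    omega
  obtain ⟨hn1, hn2⟩ := abs_le.1 hn
  -- the window bounds `|m| ≤ 2`, and of the remaining points only those listed above lie in a window
  constructor <;> rintro ⟨h1, h2⟩ <;> simp only [conj] at h1 h2
  all_goals
    obtain ⟨hm1, hm2⟩ : m ≤ 2 ∧ -2 ≤ m := by
      apply aux <;> interval_cases n <;> cases α <;> simp only [winLeft, winRight] at h1 h2 <;>
        push_cast at h1 h2 <;> linarith
    cases α <;> simp only [winLeft, winRight] at h1 h2 <;> interval_cases n <;>
      interval_cases m <;> first | assumption | (exfalso; push_cast at h1 h2; linarith)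

/-- The parent of `m + n φ` has row index `m`, by `m = conj v - n ψ` about `0.62 |n|` in absolute
value. -/
lemma abs_fst_lt_abs_snd {v : ℤ × ℤ} (hv : |conj v| ≤ 1) (hn : 2 < |v.2|) : |v.1| < |v.2| := by
  have hψ := goldenConj_bounds
  have h3 : (3 : ℝ) ≤ |(v.2 : ℝ)| := by
    rw [← Int.cast_abs]; exact_mod_cast hn
  have h1 : (v.1 : ℝ) = conj v - v.2 * ψ := by simp only [conj]; ring
  have h2 : |(v.1 : ℝ)| ≤ 1 + |(v.2 : ℝ)| * 0.62 := by
    rw [h1]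
    refine (abs_sub _ _).trans (add_le_add hv ?_)
    rw [abs_mul, abs_of_neg (by linarith : ψ < 0)]
    exact mul_le_mul_of_nonneg_left (by linarith) (abs_nonneg _)
  have : |(v.1 : ℝ)| < |(v.2 : ℝ)| := by linarith
  exact_mod_cast this

lemma winLeft_ge (α : Letter) : -1 ≤ winLeft α := by
  have hψ := goldenConj_bounds
  cases α <;> simp only [winLeft] <;> linarith

lemma winRight_le (α : Letter) : winRight α ≤ 1 := by
  have hψ := goldenConj_bounds
  cases α <;> simp only [winRight] <;> linarith

/-- Every point of the model sets is obtained from the seed, by descent along parents. -/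
lemma model_le_points (N : ℕ) : ∀ (α : Letter) (v : ℤ × ℤ), v.2.natAbs ≤ N →
    (conj v ∈ Set.Ioc (winLeft α) (winRight α) → emb v ∈ points α) ∧
    (conj v ∈ Set.Ico (winLeft α) (winRight α) → emb v ∈ inflate points α) := by
  induction N using Nat.strong_induction_on with
  | _ N ih =>
    intro α v hN
    by_cases hn : |v.2| ≤ 2
    · exact model_base hn
    have hlt : |conj v| ≤ 1 → v.1.natAbs < v.2.natAbs := by
      intro h
      have := abs_fst_lt_abs_snd h (not_le.1 hn)
      rw [Int.abs_eq_natAbs, Int.abs_eq_natAbs] at this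
      exact_mod_cast this
    constructor <;> intro hv <;>
      have hlt := hlt (abs_le.2
        ⟨by linarith [hv.1, winLeft_ge α], by linarith [hv.2, winRight_le α]⟩)
    · refine inflate_inflate_points_le α (mem_inflate_of_conj_mem_Ioc hv fun β w hw hw' => ?_)
      exact (ih _ (hlt.trans_le hN) β w (by rw [hw])).2 hw'
    · refine mem_inflate_of_conj_mem_Ico hv fun β w hw hw' => ?_
      exact (ih _ (hlt.trans_le hN) β w (by rw [hw])).1 hw'

/-- The Fibonacci chain is a cut-and-project set. -/
theorem points_eq_modelIoc : points = modelIoc := by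
  refine le_antisymm points_le_modelIoc ?_
  rintro α _ ⟨v, hv, rfl⟩
  exact (model_le_points _ α v le_rfl).1 hv

/-! ### Counting points with conjugate in an interval -/

/-- Coordinates `(m, n)` with `A ≤ n < A + M` and conjugate in `(p, q]`. -/
def strip (p q : ℝ) (A : ℤ) (M : ℕ) : Set (ℤ × ℤ) :=
  {v | conj v ∈ Set.Ioc p q ∧ A ≤ v.2 ∧ v.2 < A + M}

/-- The same set as a `Finset`, listed by rows. -/
noncomputable def stripRows (p q : ℝ) (A : ℤ) (M : ℕ) : Finset (Σ _ : ℕ, ℤ) :=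
  (Finset.range M).sigma fun i =>
    Finset.Ioc ⌊p - ((A + i : ℤ) : ℝ) * ψ⌋ ⌊q - ((A + i : ℤ) : ℝ) * ψ⌋

lemma strip_eq_image (p q : ℝ) (A : ℤ) (M : ℕ) :
    strip p q A M = (fun s : (Σ _ : ℕ, ℤ) => (s.2, A + (s.1 : ℤ))) '' ↑(stripRows p q A M) := by
  ext ⟨m, n⟩
  simp only [strip, stripRows, Set.mem_image, Finset.mem_coe, Finset.mem_sigma, Finset.mem_range,
    Finset.mem_Ioc, Set.mem_ofPred_eq, Set.mem_Ioc, conj, Int.floor_lt, Int.le_floor]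
  constructor
  · rintro ⟨⟨h1, h2⟩, h3, h4⟩
    have hn : A + ((n - A).toNat : ℤ) = n := by omega
    refine ⟨⟨(n - A).toNat, m⟩, ⟨by dsimp only; omega, ?_, ?_⟩, by simp only [hn]⟩
    · simp only [hn]; linarith
    · simp only [hn]; linarith
  · rintro ⟨⟨i, k⟩, ⟨hi, h1, h2⟩, h⟩
    simp only [Prod.mk.injEq] at h
    obtain ⟨rfl, rfl⟩ := h
    simp only at hi h1 h2
    exact ⟨⟨by linarith, by linarith⟩, by omega, by omega⟩

lemma strip_finite (p q : ℝ) (A : ℤ) (M : ℕ) : (strip p q A M).Finite := by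
  rw [strip_eq_image]
  exact (Finset.finite_toSet _).image _

lemma ncard_strip {p q : ℝ} (hpq : p ≤ q) (A : ℤ) (M : ℕ) :
    ((strip p q A M).ncard : ℝ) = ∑ i ∈ Finset.range M,
      ((⌊q - ((A + i : ℤ) : ℝ) * ψ⌋ : ℝ) - ⌊p - ((A + i : ℤ) : ℝ) * ψ⌋) := by
  rw [strip_eq_image, Set.ncard_image_of_injective, Set.ncard_coe_finset, stripRows,
    Finset.card_sigma, Nat.cast_sum]
  · refine Finset.sum_congr rfl fun i _ => ?_
    rw [Int.card_Ioc, ← Int.cast_natCast, Int.toNat_of_nonneg, Int.cast_sub]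
    have : ⌊p - ((A + i : ℤ) : ℝ) * ψ⌋ ≤ ⌊q - ((A + i : ℤ) : ℝ) * ψ⌋ :=
      Int.floor_le_floor (by linarith)
    omega
  · rintro ⟨i, k⟩ ⟨i', k'⟩ h
    simp only [Prod.mk.injEq] at h
    have : i = i' := by omega
    subst this
    simp [h.1]

/-- Shifting the summation range of a sequence with values in `[0, 1]` by `j` changes the sum by at
most `|j|`. -/
lemma abs_sum_shift_sub_le {f : ℤ → ℝ} (h0 : ∀ n, 0 ≤ f n) (h1 : ∀ n, f n ≤ 1) (M : ℕ)
    (A : ℤ) (j : ℤ) :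
    |∑ i ∈ Finset.range M, (f (A + i - j) - f (A + i))| ≤ |(j : ℝ)| := by
  have step : ∀ B : ℤ, |∑ i ∈ Finset.range M, (f (B + i + 1) - f (B + i))| ≤ 1 := by
    intro B
    have := Finset.sum_range_sub (fun i : ℕ => f (B + i)) M
    simp only [Nat.cast_add, Nat.cast_one, ← add_assoc] at this
    rw [this, abs_le]
    constructor <;> linarith [h0 (B + M), h1 (B + M), h0 (B + (0 : ℕ)), h1 (B + (0 : ℕ))]
  have pos : ∀ (k : ℕ) (B : ℤ),
      |∑ i ∈ Finset.range M, (f (B + i + k) - f (B + i))| ≤ k := by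
    intro k
    induction k with
    | zero => simp
    | succ k ih =>
      intro B
      have h := (abs_add_le _ _).trans (add_le_add (ih (B + 1)) (step B))
      rw [← Finset.sum_add_distrib] at h
      push_cast
      refine le_trans (le_of_eq ?_) h
      congr 1
      refine Finset.sum_congr rfl fun i _ => ?_
      rw [show B + 1 + (i : ℤ) + k = B + i + (k + 1) by ring,
        show B + 1 + (i : ℤ) = B + i + 1 by ring]
      ring
  rcases le_total 0 j with hj | hj
  · have h := pos j.toNat (A - j)
    have hj' : ((j.toNat : ℕ) : ℤ) = j := Int.toNat_of_nonneg hj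
    have hjr : ((j.toNat : ℕ) : ℝ) = j := by exact_mod_cast hj'
    rw [hj', hjr] at h
    rw [abs_of_nonneg (by exact_mod_cast hj : (0 : ℝ) ≤ j), ← abs_neg, ← Finset.sum_neg_distrib]
    refine le_trans (le_of_eq ?_) h
    congr 1
    refine Finset.sum_congr rfl fun i _ => ?_
    rw [neg_sub, show A - j + (i : ℤ) + j = A + i by ring,
      show A - j + (i : ℤ) = A + i - j by ring]
  · have h := pos (-j).toNat A
    have hj' : (((-j).toNat : ℕ) : ℤ) = -j := Int.toNat_of_nonneg (by omega)
    have hjr : (((-j).toNat : ℕ) : ℝ) = -j := by exact_mod_cast hj'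
    rw [hj', hjr] at h
    rw [abs_of_nonpos (by exact_mod_cast hj : (j : ℝ) ≤ 0)]
    exact h

/-- Sums of the fractional parts of `conj u - n ψ` do not depend on `u` up to a bounded error, since
for `conj u = k + l ψ` the `n`-th fractional part is that of `-(n - l) ψ`. -/
lemma abs_sum_fract_sub_le (u : ℤ × ℤ) (A : ℤ) (M : ℕ) :
    |∑ i ∈ Finset.range M, (Int.fract (conj u - ((A + i : ℤ) : ℝ) * ψ) -
      Int.fract (-((A + i : ℤ) : ℝ) * ψ))| ≤ |(u.2 : ℝ)| := by
  refine le_trans (le_of_eq ?_) (abs_sum_shift_sub_le (f := fun n : ℤ => Int.fract (-(n : ℝ) * ψ))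
    (fun n => Int.fract_nonneg _) (fun n => (Int.fract_lt_one _).le) M A u.2)
  congr 1
  refine Finset.sum_congr rfl fun i _ => ?_
  congr 1
  rw [← Int.fract_intCast_add u.1 (-((A + i - u.2 : ℤ) : ℝ) * ψ)]
  congr 1
  simp only [conj]; push_cast; ring

lemma abs_ncard_strip_sub_le (u w : ℤ × ℤ) (h : conj u ≤ conj w) (A : ℤ) (M : ℕ) :
    |((strip (conj u) (conj w) A M).ncard : ℝ) - M * (conj w - conj u)| ≤
      |(u.2 : ℝ)| + |(w.2 : ℝ)| := by
  rw [ncard_strip h]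
  refine le_trans (le_of_eq ?_) ((abs_sub _ _).trans
    (add_le_add (abs_sum_fract_sub_le u A M) (abs_sum_fract_sub_le w A M)))
  rw [← Finset.sum_sub_distrib]
  congr 1
  rw [show (M : ℝ) * (conj w - conj u) = ∑ _i ∈ Finset.range M, (conj w - conj u) by
    rw [Finset.sum_const, Finset.card_range, nsmul_eq_mul],
    ← Finset.sum_sub_distrib]
  refine Finset.sum_congr rfl fun i _ => ?_
  simp only [Int.fract]
  ring

/-- The coordinates with conjugate in `(p, q]` and row `n` with `|n| √5` at most `R`, up to a bounded
uncertainty at the boundary, have density `2 (q - p) / √5` per unit of `R`. The endpoints of the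
interval lie in `ℤ[ψ]`. -/
lemma tendsto_ncard_div (u w : ℤ × ℤ) (K : ℝ) (T : ℝ → Set (ℤ × ℤ))
    (hT1 : ∀ R v, conj v ∈ Set.Ioc (conj u) (conj w) → |(v.2 : ℝ) * √5| ≤ R - K → v ∈ T R)
    (hT2 : ∀ R v, v ∈ T R → conj v ∈ Set.Ioc (conj u) (conj w) ∧ |(v.2 : ℝ) * √5| ≤ R + K) :
    Tendsto (fun R => ((T R).ncard : ℝ) / R) atTop
      (𝓝 (2 / √5 * max 0 (conj w - conj u))) := by
  rcases lt_or_ge (conj w) (conj u) with h | h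
  · have : ∀ R, T R = ∅ := fun R => Set.eq_empty_of_forall_notMem fun v hv => by
      have := (hT2 R v hv).1
      linarith [this.1, this.2]
    simp only [this, max_eq_left (sub_nonpos.2 h.le)]
    simp
  rw [max_eq_right (sub_nonneg.2 h)]
  set d := conj w - conj u with hd
  have hd0 : 0 ≤ d := sub_nonneg.2 h
  set c := |(u.2 : ℝ)| + |(w.2 : ℝ)| with hc
  have h5 : 0 < √5 := by positivity
  have habs : ∀ n : ℤ, |(n : ℝ) * √5| = |(n : ℝ)| * √5 := fun n => by
    rw [abs_mul, abs_of_pos h5]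
  -- the strip `|n| ≤ N`
  have key : ∀ N : ℕ,
      |((strip (conj u) (conj w) (-N) (2 * N + 1)).ncard : ℝ) - (2 * N + 1) * d| ≤ c := by
    intro N
    have := abs_ncard_strip_sub_le u w h (-N) (2 * N + 1)
    push_cast at this
    exact this
  have mem_strip : ∀ (N : ℕ) (v : ℤ × ℤ), v ∈ strip (conj u) (conj w) (-N) (2 * N + 1) ↔
      conj v ∈ Set.Ioc (conj u) (conj w) ∧ |(v.2 : ℝ)| ≤ N := by
    intro N v
    simp only [strip, Set.mem_ofPred_eq]
    refine and_congr_right fun _ => ?_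
    rw [← Int.cast_abs, ← Int.cast_natCast (R := ℝ) N, Int.cast_le, abs_le]
    push_cast
    omega
  -- the row bounds `(R ± K) / √5` are off by at most `|K| / √5`, plus `1` from rounding
  set C := c + (2 * (|K| / √5) + 1) * d with hC
  have bound : ∀ R, |K| ≤ R → |((T R).ncard : ℝ) - 2 / √5 * d * R| ≤ C := by
    intro R hR
    have hKR : 0 ≤ R - K := by linarith [le_abs_self K]
    have hKR' : 0 ≤ R + K := by linarith [neg_abs_le K]
    have lo : strip (conj u) (conj w) (-(⌊(R - K) / √5⌋₊ : ℤ)) (2 * ⌊(R - K) / √5⌋₊ + 1) ⊆ T R := by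
      intro v hv
      obtain ⟨h1, h2⟩ := (mem_strip _ v).1 hv
      refine hT1 R v h1 ?_
      rw [habs, ← le_div_iff₀ h5]
      exact h2.trans (Nat.floor_le (by positivity))
    have hi : T R ⊆ strip (conj u) (conj w) (-(⌊(R + K) / √5⌋₊ : ℤ)) (2 * ⌊(R + K) / √5⌋₊ + 1) := by
      intro v hv
      obtain ⟨h1, h2⟩ := hT2 R v hv
      refine (mem_strip _ v).2 ⟨h1, ?_⟩
      rw [habs, ← le_div_iff₀ h5, ← Int.cast_abs, Int.abs_eq_natAbs, Int.cast_natCast] at h2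
      rw [← Int.cast_abs, Int.abs_eq_natAbs, Int.cast_natCast, Nat.cast_le]
      exact Nat.le_floor h2
    have hlo := Set.ncard_le_ncard lo ((strip_finite _ _ _ _).subset hi)
    have hhi := Set.ncard_le_ncard hi (strip_finite _ _ _ _)
    have hlo' : (_ : ℝ) ≤ _ := Nat.cast_le.2 hlo
    have hhi' : (_ : ℝ) ≤ _ := Nat.cast_le.2 hhi
    have k1 := (abs_le.1 (key ⌊(R - K) / √5⌋₊)).1
    have k2 := (abs_le.1 (key ⌊(R + K) / √5⌋₊)).2
    have f1 : R / √5 - |K| / √5 - 1 ≤ (⌊(R - K) / √5⌋₊ : ℝ) := by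
      have := (Nat.lt_floor_add_one ((R - K) / √5)).le
      have h2 : K / √5 ≤ |K| / √5 := by gcongr; exact le_abs_self K
      have h3 : (R - K) / √5 = R / √5 - K / √5 := sub_div _ _ _
      linarith
    have f2 : (⌊(R + K) / √5⌋₊ : ℝ) ≤ R / √5 + |K| / √5 := by
      have := Nat.floor_le (div_nonneg hKR' h5.le)
      have h2 : K / √5 ≤ |K| / √5 := by gcongr; exact le_abs_self K
      have h3 : (R + K) / √5 = R / √5 + K / √5 := add_div _ _ _
      linarith
    have g1 := mul_le_mul_of_nonneg_right f1 hd0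
    have g2 := mul_le_mul_of_nonneg_right f2 hd0
    have e : 2 / √5 * d * R = 2 * (R / √5 * d) := by ring
    rw [e, hC, abs_le]
    constructor <;> linarith
  have hz : Tendsto (fun R : ℝ => ((T R).ncard : ℝ) / R - 2 / √5 * d) atTop (𝓝 0) := by
    refine squeeze_zero_norm' ?_ (tendsto_const_nhds (x := C).div_atTop tendsto_id)
    filter_upwards [eventually_ge_atTop |K|, eventually_gt_atTop 0] with R hR hR0
    rw [Real.norm_eq_abs, id, show ((T R).ncard : ℝ) / R - 2 / √5 * d =
      (((T R).ncard : ℝ) - 2 / √5 * d * R) / R by field_simp, abs_div, abs_of_pos hR0]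
    gcongr
    exact bound R hR
  simpa using hz.add_const (2 / √5 * d)

/-! ### Pair frequencies as overlaps of windows -/

/-- The length of the intersection of an interval from `p` to `q` with one from `p'` to `q'`. -/
noncomputable def overlap (p q p' q' : ℝ) : ℝ := max 0 (min q q' - max p p')

/-- The length of the overlap of the window of type `α` with that of type `β` translated by `-s`. -/
noncomputable def winOverlap (α β : Letter) (s : ℝ) : ℝ :=
  overlap (winLeft α) (winRight α) (winLeft β - s) (winRight β - s)

lemma exists_conj_eq_winLeft (α : Letter) : ∃ v, conj v = winLeft α := by
  cases α
  · exact ⟨(-1, -1), by simp [conj, winLeft]; ring⟩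
  · exact ⟨(-1, 0), by simp [conj, winLeft]⟩

lemma exists_conj_eq_winRight (α : Letter) : ∃ v, conj v = winRight α := by
  cases α
  · exact ⟨(0, -1), by simp [conj, winRight]⟩
  · exact ⟨(-1, -1), by simp [conj, winRight]; ring⟩

lemma exists_conj_eq_max (v w : ℤ × ℤ) : ∃ u, conj u = max (conj v) (conj w) := by
  rcases max_choice (conj v) (conj w) with h | h <;> exact ⟨_, h.symm⟩

lemma exists_conj_eq_min (v w : ℤ × ℤ) : ∃ u, conj u = min (conj v) (conj w) := by
  rcases min_choice (conj v) (conj w) with h | h <;> exact ⟨_, h.symm⟩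

lemma emb_mem_points {α : Letter} {v : ℤ × ℤ} :
    emb v ∈ points α ↔ conj v ∈ Set.Ioc (winLeft α) (winRight α) := by
  rw [points_eq_modelIoc]
  exact emb_injective.mem_set_image

lemma exists_emb_of_mem_points {α : Letter} {x : ℝ} (hx : x ∈ points α) : ∃ v, emb v = x := by
  rw [points_eq_modelIoc] at hx
  obtain ⟨v, -, h⟩ := hx
  exact ⟨v, h⟩

lemma emb_mem_allPoints {v : ℤ × ℤ} : emb v ∈ allPoints ↔ conj v ∈ Set.Ioc (-1) (-ψ) := by
  have hψ := goldenConj_bounds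
  simp only [allPoints, Set.mem_union, emb_mem_points, winLeft, winRight, Set.mem_Ioc]
  constructor
  · rintro (h | h) <;> constructor <;> linarith
  · intro h
    rcases le_or_gt (conj v) (-1 - ψ) with h' | h'
    · exact Or.inr ⟨h.1, h'⟩
    · exact Or.inl ⟨h', h.2⟩

lemma tendsto_ncard_allPoints :
    Tendsto (fun R : ℝ => ((allPoints ∩ Set.Ioo (-R) R).ncard : ℝ) / R) atTop
      (𝓝 (2 / √5 * φ)) := by
  have hψ := goldenConj_bounds
  have hu : conj (-1, 0) = -1 := by simp [conj]
  have hw : conj (0, -1) = -ψ := by simp [conj]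
  have hset : ∀ R : ℝ, allPoints ∩ Set.Ioo (-R) R =
      emb '' {v | emb v ∈ allPoints ∧ emb v ∈ Set.Ioo (-R) R} := by
    intro R
    ext x
    constructor
    · rintro ⟨hx, hR⟩
      obtain ⟨v, rfl⟩ : ∃ v, emb v = x := hx.elim exists_emb_of_mem_points exists_emb_of_mem_points
      exact ⟨v, ⟨hx, hR⟩, rfl⟩
    · rintro ⟨v, ⟨hx, hR⟩, rfl⟩
      exact ⟨hx, hR⟩
  simp only [hset, Set.ncard_image_of_injective _ emb_injective]
  have h := tendsto_ncard_div (-1, 0) (0, -1) 2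
    (fun R => {v | emb v ∈ allPoints ∧ emb v ∈ Set.Ioo (-R) R}) ?_ ?_
  · rw [hu, hw, max_eq_right (by linarith)] at h
    rwa [← Real.one_sub_goldenRatio, show (1 - ψ : ℝ) = -ψ - -1 by ring]
  · intro R v hv hR
    rw [hu, hw] at hv
    refine ⟨emb_mem_allPoints.2 hv, ?_⟩
    rw [← emb_sub_conj] at hR
    obtain ⟨h1, h2⟩ := abs_le.1 hR
    constructor <;> linarith [hv.1, hv.2]
  · rintro R v ⟨hv, hR⟩
    rw [hu, hw]
    have hv' := emb_mem_allPoints.1 hv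
    refine ⟨hv', ?_⟩
    rw [← emb_sub_conj, abs_le]
    constructor <;> linarith [hv'.1, hv'.2, hR.1, hR.2]

/-- A pair of points at distance `emb t` is a point whose conjugate lies in the window of `α` and in
that of `β` translated by `-conj t`; that both points lie in `(-R, R)` changes the count by a bounded
amount only. -/
lemma tendsto_ncard_pairs (α β : Letter) (t : ℤ × ℤ) :
    Tendsto (fun R : ℝ => ({x : ℝ | x ∈ points α ∩ Set.Ioo (-R) R ∧
      x + emb t ∈ points β ∩ Set.Ioo (-R) R}.ncard : ℝ) / R) atTop
      (𝓝 (2 / √5 * winOverlap α β (conj t))) := by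
  obtain ⟨pα, hpα⟩ := exists_conj_eq_winLeft α
  obtain ⟨qα, hqα⟩ := exists_conj_eq_winRight α
  obtain ⟨pβ, hpβ⟩ := exists_conj_eq_winLeft β
  obtain ⟨qβ, hqβ⟩ := exists_conj_eq_winRight β
  obtain ⟨u, hu⟩ := exists_conj_eq_max pα (pβ - t)
  obtain ⟨w, hw⟩ := exists_conj_eq_min qα (qβ - t)
  rw [conj_sub, hpα, hpβ] at hu
  rw [conj_sub, hqα, hqβ] at hw
  have hset : ∀ R : ℝ, {x : ℝ | x ∈ points α ∩ Set.Ioo (-R) R ∧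
      x + emb t ∈ points β ∩ Set.Ioo (-R) R} =
      emb '' {v | (emb v ∈ points α ∧ emb (v + t) ∈ points β) ∧
        emb v ∈ Set.Ioo (-R) R ∧ emb (v + t) ∈ Set.Ioo (-R) R} := by
    intro R
    ext x
    constructor
    · rintro ⟨⟨hx, hR⟩, hx', hR'⟩
      obtain ⟨v, rfl⟩ := exists_emb_of_mem_points hx
      rw [← emb_add] at hx' hR'
      exact ⟨v, ⟨⟨hx, hx'⟩, hR, hR'⟩, rfl⟩
    · rintro ⟨v, ⟨⟨hx, hx'⟩, hR, hR'⟩, rfl⟩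
      rw [emb_add] at hx' hR'
      exact ⟨⟨hx, hR⟩, hx', hR'⟩
  have hmem : ∀ v, (emb v ∈ points α ∧ emb (v + t) ∈ points β) ↔
      conj v ∈ Set.Ioc (conj u) (conj w) := by
    intro v
    simp only [emb_mem_points, Set.mem_Ioc, conj_add, hu, hw, max_lt_iff, le_min_iff,
      sub_lt_iff_lt_add, le_sub_iff_add_le]
    tauto
  have hbd : ∀ v, conj v ∈ Set.Ioc (conj u) (conj w) → -1 < conj v ∧ conj v ≤ 1 := by
    intro v hv
    have := emb_mem_points.1 ((hmem v).2 hv).1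
    exact ⟨(winLeft_ge α).trans_lt this.1, this.2.trans (winRight_le α)⟩
  simp only [hset, Set.ncard_image_of_injective _ emb_injective]
  have h := tendsto_ncard_div u w (2 + |emb t|)
    (fun R => {v | (emb v ∈ points α ∧ emb (v + t) ∈ points β) ∧
        emb v ∈ Set.Ioo (-R) R ∧ emb (v + t) ∈ Set.Ioo (-R) R}) ?_ ?_
  · rwa [hu, hw] at h
  · intro R v hv hR
    refine ⟨(hmem v).2 hv, ?_⟩
    obtain ⟨b1, b2⟩ := hbd v hv
    rw [← emb_sub_conj] at hR
    obtain ⟨h1, h2⟩ := abs_le.1 hR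
    have h3 := neg_abs_le (emb t)
    have h4 := le_abs_self (emb t)
    rw [emb_add]
    exact ⟨⟨by linarith, by linarith⟩, by linarith, by linarith⟩
  · rintro R v ⟨hv, hR, -⟩
    have hv' := (hmem v).1 hv
    obtain ⟨b1, b2⟩ := hbd v hv'
    refine ⟨hv', ?_⟩
    rw [← emb_sub_conj, abs_le]
    constructor <;> linarith [hR.1, hR.2, abs_nonneg (emb t)]

/-- The pair frequencies are ratios of two counts of order `R`: the pairs are the points of `ℤ[φ]`
with conjugate in the overlap, and all points together have a window of length `φ`. -/
theorem tendsto_pairFrequency (α β : Letter) (t : ℤ × ℤ) :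
    Tendsto (pairFrequency α β (emb t)) atTop (𝓝 (winOverlap α β (conj t) / φ)) := by
  have h5 : (√5 : ℝ) ≠ 0 := by positivity
  have h := (tendsto_ncard_pairs α β t).div tendsto_ncard_allPoints
    (mul_ne_zero (by positivity) Real.goldenRatio_ne_zero)
  rw [mul_div_mul_left _ _ (by positivity : (2 / √5 : ℝ) ≠ 0)] at h
  refine h.congr' ?_
  filter_upwards [eventually_gt_atTop 0] with R hR
  exact div_div_div_cancel_right₀ hR.ne' _ _

theorem pairCorrelation_emb (α β : Letter) (t : ℤ × ℤ) :
    pairCorrelation α β (emb t) = winOverlap α β (conj t) / φ :=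
  (tendsto_pairFrequency α β t).limUnder_eq

lemma pairFrequency_of_notMem {α β : Letter} {z : ℝ} (hz : z ∉ points β - points α) (R : ℝ) :
    pairFrequency α β z R = 0 := by
  have : {x : ℝ | x ∈ points α ∩ Set.Ioo (-R) R ∧ x + z ∈ points β ∩ Set.Ioo (-R) R} = ∅ := by
    refine Set.eq_empty_of_forall_notMem fun x hx => hz ?_
    exact Set.mem_sub.2 ⟨x + z, hx.2.1, x, hx.1.1, by ring⟩
  rw [pairFrequency, this]
  simp

lemma tendsto_pairFrequency_of_notMem {α β : Letter} {z : ℝ} (hz : z ∉ points β - points α) :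
    Tendsto (pairFrequency α β z) atTop (𝓝 0) :=
  tendsto_const_nhds.congr fun R => (pairFrequency_of_notMem hz R).symm

lemma exists_emb_of_mem_sub {α β : Letter} {z : ℝ} (hz : z ∈ points β - points α) :
    ∃ t, emb t = z := by
  obtain ⟨y, hy, x, hx, rfl⟩ := Set.mem_sub.1 hz
  obtain ⟨v, rfl⟩ := exists_emb_of_mem_points hy
  obtain ⟨w, rfl⟩ := exists_emb_of_mem_points hx
  exact ⟨v - w, by rw [eq_sub_iff_add_eq, ← emb_add, sub_add_cancel]⟩

/-! ### Renormalisation of the overlaps -/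

/-- Scaling by `-r < 0` and translating scales the overlap of two intervals by `r`. -/
lemma overlap_reflect {r : ℝ} (hr : 0 ≤ r) (c p q p' q' : ℝ) :
    overlap (c - r * q) (c - r * p) (c - r * q') (c - r * p') = r * overlap p q p' q' := by
  simp only [overlap]
  rw [mul_max_of_nonneg _ _ hr, mul_sub, mul_min_of_nonneg _ _ hr, mul_max_of_nonneg _ _ hr,
    min_sub_sub_left, max_sub_sub_left, mul_zero]
  congr 1; ring

lemma overlap_add_left {p m q : ℝ} (h1 : p ≤ m) (h2 : m ≤ q) (p' q' : ℝ) :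
    overlap p m p' q' + overlap m q p' q' = overlap p q p' q' := by
  simp only [overlap, max_def, min_def]
  split_ifs <;> linarith

lemma overlap_comm (p q p' q' : ℝ) : overlap p q p' q' = overlap p' q' p q := by
  rw [overlap, overlap, min_comm, max_comm p]

lemma overlap_add_right {p' m q' : ℝ} (h1 : p' ≤ m) (h2 : m ≤ q') (p q : ℝ) :
    overlap p q p' m + overlap p q m q' = overlap p q p' q' := by
  simp only [overlap_comm p q, overlap_add_left h1 h2]

/-- Merging the windows of the second point of a pair. -/
lemma winOverlap_a_add_winOverlap_b_right (α : Letter) (s : ℝ) :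
    winOverlap α .a s + winOverlap α .b s =
      overlap (winLeft α) (winRight α) (-1 - s) (-ψ - s) := by
  have hψ := goldenConj_bounds
  rw [add_comm]
  simp only [winOverlap, winLeft, winRight]
  exact overlap_add_right (by linarith) (by linarith) _ _

/-- Merging the windows of the first point of a pair. -/
lemma winOverlap_a_add_winOverlap_b_left (β : Letter) (s : ℝ) :
    winOverlap .a β s + winOverlap .b β s =
      overlap (-1) (-ψ) (winLeft β - s) (winRight β - s) := by
  have hψ := goldenConj_bounds
  rw [add_comm]
  simp only [winOverlap, winLeft, winRight]
  exact overlap_add_left (by linarith) (by linarith) _ _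

lemma winOverlap_aa (s : ℝ) : winOverlap .a .a (ψ * s) = 1 / φ *
    (winOverlap .a .a s + winOverlap .a .b s + winOverlap .b .a s + winOverlap .b .b s) := by
  have hψ := goldenConj_bounds
  have hsq := Real.goldenConj_sq
  rw [add_assoc, winOverlap_a_add_winOverlap_b_right, winOverlap_a_add_winOverlap_b_right, add_comm]
  simp only [winOverlap, winLeft, winRight]
  rw [overlap_add_left (by linarith) (by linarith), one_div, Real.inv_goldenRatio,
    ← overlap_reflect (by linarith) 0]
  congr 1 <;> linarith

lemma winOverlap_ab (s : ℝ) : winOverlap .a .b (ψ * s) = 1 / φ *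
    (winOverlap .a .a (s - 1) + winOverlap .b .a (s - 1)) := by
  have hψ := goldenConj_bounds
  have hsq := Real.goldenConj_sq
  rw [winOverlap_a_add_winOverlap_b_left, one_div, Real.inv_goldenRatio,
    ← overlap_reflect (by linarith) 0]
  simp only [winOverlap, winLeft, winRight]
  congr 1 <;> linarith

lemma winOverlap_ba (s : ℝ) : winOverlap .b .a (ψ * s) = 1 / φ *
    (winOverlap .a .a (s + 1) + winOverlap .a .b (s + 1)) := by
  have hψ := goldenConj_bounds
  have hsq := Real.goldenConj_sq
  rw [winOverlap_a_add_winOverlap_b_right, one_div, Real.inv_goldenRatio,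
    ← overlap_reflect (by linarith) ψ]
  simp only [winOverlap, winLeft, winRight]
  congr 1 <;> linarith

lemma winOverlap_bb (s : ℝ) : winOverlap .b .b (ψ * s) = 1 / φ * winOverlap .a .a s := by
  have hψ := goldenConj_bounds
  have hsq := Real.goldenConj_sq
  simp only [winOverlap, winLeft, winRight]
  rw [one_div, Real.inv_goldenRatio, ← overlap_reflect (by linarith) ψ]
  congr 1 <;> linarith

end FibonacciChain

theorem mainTheorem3 :
    -- the pair correlation coefficients exist as limits
    (∀ (α β : Letter) (z : ℝ),
      Tendsto (fun R : ℝ => pairFrequency α β z R) atTop (𝓝 (pairCorrelation α β z))) ∧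
    -- the exact renormalisation relations
    (∀ z ∈ Algebra.adjoin ℤ {Real.goldenRatio},
      pairCorrelation .a .a z = 1 / Real.goldenRatio *
        (pairCorrelation .a .a (z / Real.goldenRatio) +
          pairCorrelation .a .b (z / Real.goldenRatio) +
          pairCorrelation .b .a (z / Real.goldenRatio) +
          pairCorrelation .b .b (z / Real.goldenRatio)) ∧
      pairCorrelation .a .b z = 1 / Real.goldenRatio *
        (pairCorrelation .a .a (z / Real.goldenRatio - 1) +
          pairCorrelation .b .a (z / Real.goldenRatio - 1)) ∧
      pairCorrelation .b .a z = 1 / Real.goldenRatio *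
        (pairCorrelation .a .a (z / Real.goldenRatio + 1) +
          pairCorrelation .a .b (z / Real.goldenRatio + 1)) ∧
      pairCorrelation .b .b z = 1 / Real.goldenRatio *
        pairCorrelation .a .a (z / Real.goldenRatio)) ∧
    -- the support condition
    (∀ (α β : Letter) (z : ℝ), z ∉ points β - points α → pairCorrelation α β z = 0) := by
  refine ⟨fun α β z => ?_, fun z hz => ?_, fun α β z hz =>
    (tendsto_pairFrequency_of_notMem hz).limUnder_eq⟩
  · by_cases hz : z ∈ points β - points α
    · obtain ⟨t, rfl⟩ := exists_emb_of_mem_sub hz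
      rw [pairCorrelation_emb]
      exact tendsto_pairFrequency α β t
    · rw [show pairCorrelation α β z = 0 from (tendsto_pairFrequency_of_notMem hz).limUnder_eq]
      exact tendsto_pairFrequency_of_notMem hz
  · -- the conjugate of `z / φ` is the conjugate of `z` divided by `ψ`
    obtain ⟨t, rfl⟩ := exists_emb_of_mem_adjoin hz
    have h1 : emb (1, 0) = 1 := by simp [emb]
    have h1' : conj (1, 0) = 1 := by simp [conj]
    have hsub : emb (divPhi t) - 1 = emb (divPhi t - (1, 0)) := by
      rw [sub_eq_iff_eq_add, ← h1, ← emb_add, sub_add_cancel]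
    have hadd : emb (divPhi t) + 1 = emb (divPhi t + (1, 0)) := by rw [emb_add, h1]
    rw [← emb_divPhi, hsub, hadd]
    simp only [pairCorrelation_emb, conj_add, conj_sub, h1', conj_eq_mul_conj_divPhi t,
      winOverlap_aa, winOverlap_ab, winOverlap_ba, winOverlap_bb]
    refine ⟨?_, ?_, ?_, ?_⟩ <;> ring
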